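/- Let $\Omega\subset\mathbb R^d$ be nonempty, closed and convex, let $P_\Omega$ be the metric projection onto $\Omega$, and let $U:\mathbb R^d\to\mathbb R^d$ be a map whose restriction to $\Omega$ is continuous and paramonotone, i.e. for all $a,b\in\Omega$ one has $\langle U(a)-U(b),a-b\rangle\ge 0$, and $\langle U(a)-U(b),a-b\rangle=0$ if and only if $U(a)=U(b)$ (nothing is assumed about $U$ outside $\Omega$). Assume that the solution set $$S=\{x_\star\in\Omega:\ \langle U(x_\star),a-x_\star\rangle\ge 0\ \text{ for all } a\in\Omega\}$$ of the variational inequality VI$(U,\Omega)$ is nonempty. Let $t_0\in\mathbb R$, $\alpha_0,\alpha_1,\delta:[t_0,\infty)\to(0,\infty)$ and $\lambda:[t_0,\infty)\to[0,\infty)$ satisfy the following conditions. 1. There are constants $C_1,C_2>0$ with $2\alpha_1(t)-2\delta(t)\lambda(t)-C_2\delta(t)\ge C_1$ for all $t\ge t_0$. 2. $\alpha_0$ and $\delta$ are locally integrable on $[t_0,\infty)$; $\alpha_1,\delta,\lambda$ are locally absolutely continuous on $[t_0,\infty)$; $\lambda$ is bounded above. 3. $\delta(t)<\frac14\bigl(\alpha_1(t)^2+2\alpha_1'(t)\bigr)$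 for almost every $t\ge t_0$. 4. $\lambda(t)\gamma(t)\le 1$ for all $t\ge t_0$, where $\gamma:[t_0,\infty)\to\mathbb R$ is the solution of $\gamma'+\alpha_1\gamma=\gamma^2+\delta$, $\gamma(t_0)=\frac14\alpha_1(t_0)$ (which exists on $[t_0,\infty)$ and is unique under the other conditions). 5. $\frac{d}{dt}\bigl[\alpha_1(t)-\delta(t)\lambda(t)\bigr]\le 0$ for almost every $t\ge t_0$. 6. $\int_{t_0}^\infty\delta(t)\alpha_0(t)^2\,dt<\infty$ and $\int_{t_0}^\infty\delta(t)\alpha_0(t)\,dt=\infty$. Let $x_0,x_1\in\Omega$ and let $x:[t_0,\infty)\to\mathbb R^d$ be a strong global solution of $$x''(t)+\alpha_1(t)x'(t)=\delta(t)\,[y(t)-x(t)],\qquad x(t_0)=x_0,\quad x'(t_0)=\tfrac14\alpha_1(t_0)(x_1-x_0),$$ where $$y(t)=P_\Omega\Bigl(z(t)-\frac{\alpha_0(t)}{\max\{1,\|U(z(t))\|\}}\,U(z(t))\Bigr),\qquad z(t)=x(t)+\lambda(t)x'(t).$$ That is, the derivatives $x'$ and $x''$ exist on $[t_0,\infty)$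 (one-sided at $t_0$), $x,x',x''$ are absolutely continuous on every interval $[a,b]$ with $t_0<a<b$, the differential equation holds for almost every $t\ge t_0$, and the initial conditions hold. Then: (i) $\|x''\|\in L^2([t_0,\infty))$; (ii) $\lim_{t\to\infty}x'(t)=0$; (iii) there is $x_\star\in S$ with $\lim_{t\to\infty}x(t)=x_\star$. -/

import Mathlib

open MeasureTheory Set Filter Topology

section VariationalInequality

variable {E : Type*} [NormedAddCommGroup E] [InnerProductSpace ℝ E]

/-- The solution set of the variational inequality of `U` on `Ω`: the points `x ∈ Ω` such that
`⟪U x, a - x⟫ ≥ 0` for all `a ∈ Ω`. -/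
def viSolutionSet (U : E → E) (Ω : Set E) : Set E :=
  {x | x ∈ Ω ∧ ∀ a ∈ Ω, 0 ≤ inner ℝ (U x) (a - x)}

/-- `U` is monotone on `Ω` (in the sense of operators on an inner product space). -/
def IsMonotoneOperatorOn (U : E → E) (Ω : Set E) : Prop :=
  ∀ a ∈ Ω, ∀ b ∈ Ω, 0 ≤ inner ℝ (U a - U b) (a - b)

/-- `U` is paramonotone on `Ω`. -/
def IsParamonotoneOn (U : E → E) (Ω : Set E) : Prop :=
  IsMonotoneOperatorOn U Ω ∧
    ∀ a ∈ Ω, ∀ b ∈ Ω, inner ℝ (U a - U b) (a - b) = 0 ↔ U a = U b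

open Classical in
/-- The metric projection `P_Ω z`: a point of `Ω` nearest to `z`. For a nonempty, closed, convex
subset of a complete space it exists and is unique (`metricProj_mem`, `dist_metricProj_le`,
`eq_metricProj`); the value is `z` when there is no nearest point. -/
noncomputable def metricProj (Ω : Set E) (z : E) : E :=
  if h : ∃ p ∈ Ω, ∀ q ∈ Ω, dist z p ≤ dist z q then h.choose else z

theorem exists_nearest [CompleteSpace E] {Ω : Set E} (hne : Ω.Nonempty) (hcl : IsClosed Ω)
    (hcv : Convex ℝ Ω) (z : E) : ∃ p ∈ Ω, ∀ q ∈ Ω, dist z p ≤ dist z q := by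
  obtain ⟨p, hp, h⟩ := exists_norm_eq_iInf_of_complete_convex hne hcl.isComplete hcv z
  refine ⟨p, hp, fun q hq => ?_⟩
  rw [dist_eq_norm, dist_eq_norm, h]
  exact ciInf_le (f := fun w : Ω => ‖z - w‖) ⟨0, by rintro _ ⟨w, rfl⟩; positivity⟩ ⟨q, hq⟩

theorem metricProj_mem [CompleteSpace E] {Ω : Set E} (hne : Ω.Nonempty) (hcl : IsClosed Ω)
    (hcv : Convex ℝ Ω) (z : E) : metricProj Ω z ∈ Ω := by
  have h := exists_nearest hne hcl hcv z
  rw [metricProj, dif_pos h]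
  exact h.choose_spec.1

theorem dist_metricProj_le [CompleteSpace E] {Ω : Set E} (hne : Ω.Nonempty) (hcl : IsClosed Ω)
    (hcv : Convex ℝ Ω) (z : E) {q : E} (hq : q ∈ Ω) : dist z (metricProj Ω z) ≤ dist z q := by
  have h := exists_nearest hne hcl hcv z
  rw [metricProj, dif_pos h]
  exact h.choose_spec.2 q hq

theorem eq_metricProj [CompleteSpace E] {Ω : Set E} (hcl : IsClosed Ω)
    (hcv : Convex ℝ Ω) {z p : E} (hp : p ∈ Ω) (h : ∀ q ∈ Ω, dist z p ≤ dist z q) :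
    p = metricProj Ω z := by
  have key : ∀ r ∈ Ω, (∀ q ∈ Ω, dist z r ≤ dist z q) →
      ∀ w ∈ Ω, inner ℝ (z - r) (w - r) ≤ 0 := by
    intro r hr hmin
    refine (norm_eq_iInf_iff_real_inner_le_zero hcv hr).1 ?_
    have : Nonempty Ω := ⟨⟨r, hr⟩⟩
    refine le_antisymm (le_ciInf fun w => ?_) ?_
    · simpa [dist_eq_norm] using hmin w w.2
    · exact ciInf_le (f := fun w : Ω => ‖z - w‖) ⟨0, by rintro _ ⟨w, rfl⟩; positivity⟩ ⟨r, hr⟩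
  have hne : Ω.Nonempty := ⟨p, hp⟩
  have hm := metricProj_mem hne hcl hcv z
  have h1 := key p hp h _ hm
  have h2 := key _ hm (fun q hq => dist_metricProj_le hne hcl hcv z hq) p hp
  set m := metricProj Ω z
  have h3 : inner ℝ (p - m) (p - m) ≤ (0 : ℝ) := by
    have e : inner ℝ (p - m) (p - m) = inner ℝ (z - p) (m - p) + inner ℝ (z - m) (p - m) := by
      simp only [inner_sub_left, inner_sub_right]
      ring
    linarith
  rw [real_inner_self_eq_norm_sq] at h3
  exact sub_eq_zero.1 (norm_eq_zero.1 (by nlinarith [norm_nonneg (p - m)]))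

/-- The normalized projection step
`P_Ω (z - (a / max {1, ‖U z‖}) U z)` of length parameter `a`, started at `z`. -/
noncomputable def projStep (U : E → E) (Ω : Set E) (a : ℝ) (z : E) : E :=
  metricProj Ω (z - (a / max 1 ‖U z‖) • U z)

end VariationalInequality

/-- `f` is locally absolutely continuous on `[t₀, ∞)`. -/
def LocallyACFrom {X : Type*} [PseudoMetricSpace X] (t₀ : ℝ) (f : ℝ → X) : Prop :=
  ∀ a b : ℝ, t₀ ≤ a → a ≤ b → AbsolutelyContinuousOnInterval f a b

/-- `γ` solves the Riccati problem `γ' + α₁ γ = γ² + δ` on `[t₀, ∞)`, `γ(t₀) = α₁(t₀) / 4`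
(the derivative at `t₀` is one-sided). -/
def IsRiccatiSolution (t₀ : ℝ) (α₁ δ γ : ℝ → ℝ) : Prop :=
  γ t₀ = α₁ t₀ / 4 ∧
    ∀ t, t₀ ≤ t → HasDerivWithinAt γ (γ t ^ 2 + δ t - α₁ t * γ t) (Ici t₀) t

/-- The conditions on the coefficients `α₀, α₁, δ : [t₀, ∞) → (0, ∞)` and
`lam : [t₀, ∞) → [0, ∞)` of the dynamical system. Conditions on derivatives of locally absolutely
continuous functions are imposed almost everywhere. In `lam_mul_riccati_le`, the function `γ` is
the solution on `[t₀, ∞)` of the Riccati problem; its existence is not assumed. -/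
structure CoefficientConditions (t₀ : ℝ) (α₀ α₁ δ lam : ℝ → ℝ) : Prop where
  α₀_pos : ∀ t, t₀ ≤ t → 0 < α₀ t
  α₁_pos : ∀ t, t₀ ≤ t → 0 < α₁ t
  δ_pos : ∀ t, t₀ ≤ t → 0 < δ t
  lam_nonneg : ∀ t, t₀ ≤ t → 0 ≤ lam t
  damping : ∃ C₁ > (0 : ℝ), ∃ C₂ > (0 : ℝ), ∀ t, t₀ ≤ t →
    C₁ ≤ 2 * α₁ t - 2 * δ t * lam t - C₂ * δ t
  δ_lt : ∀ᵐ t ∂(volume.restrict (Ici t₀)), δ t < (α₁ t ^ 2 + 2 * deriv α₁ t) / 4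
  α₀_locInt : LocallyIntegrableOn α₀ (Ici t₀) volume
  δ_locInt : LocallyIntegrableOn δ (Ici t₀) volume
  α₁_ac : LocallyACFrom t₀ α₁
  δ_ac : LocallyACFrom t₀ δ
  lam_ac : LocallyACFrom t₀ lam
  lam_bdd : BddAbove (lam '' Ici t₀)
  lam_mul_riccati_le : ∀ γ : ℝ → ℝ, IsRiccatiSolution t₀ α₁ δ γ → ∀ t, t₀ ≤ t → lam t * γ t ≤ 1
  deriv_nonpos : ∀ᵐ t ∂(volume.restrict (Ici t₀)), deriv (fun s => α₁ s - δ s * lam s) t ≤ 0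
  lintegral_sq_lt_top : ∫⁻ t in Ici t₀, ENNReal.ofReal (δ t * α₀ t ^ 2) < ⊤
  lintegral_eq_top : ∫⁻ t in Ici t₀, ENNReal.ofReal (δ t * α₀ t) = ⊤

/-- `x`, with first and second derivatives `x'` and `x''` on `[t₀, ∞)` (one-sided at `t₀`), is a
strong global solution of
`x'' + α₁ x' = δ (y - x)`, `y = P_Ω (z - (α₀ / max {1, ‖U z‖}) U z)`, `z = x + lam x'`,
with `x(t₀) = x₀`, `x'(t₀) = (α₁(t₀) / 4) (x₁ - x₀)`. -/
structure IsStrongGlobalSolution {E : Type*} [NormedAddCommGroup E] [InnerProductSpace ℝ E]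
    (U : E → E) (Ω : Set E) (t₀ : ℝ) (α₀ α₁ δ lam : ℝ → ℝ) (x₀ x₁ : E)
    (x x' x'' : ℝ → E) : Prop where
  hasDeriv : ∀ t, t₀ ≤ t → HasDerivWithinAt x (x' t) (Ici t₀) t
  hasDeriv' : ∀ t, t₀ ≤ t → HasDerivWithinAt x' (x'' t) (Ici t₀) t
  ac : ∀ a b : ℝ, t₀ < a → a < b → AbsolutelyContinuousOnInterval x a b
  ac' : ∀ a b : ℝ, t₀ < a → a < b → AbsolutelyContinuousOnInterval x' a b
  ac'' : ∀ a b : ℝ, t₀ < a → a < b → AbsolutelyContinuousOnInterval x'' a b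
  equation : ∀ᵐ t ∂(volume.restrict (Ici t₀)),
    x'' t + α₁ t • x' t = δ t • (projStep U Ω (α₀ t) (x t + lam t • x' t) - x t)
  init : x t₀ = x₀
  init' : x' t₀ = (α₁ t₀ / 4) • (x₁ - x₀)

/-! The step at `z` is controlled only when `z` lies in `Ω`, so viability comes first. With `γ` a
positive solution of the Riccati problem and `w = x + x' / γ`, the second-order equation factors as
`x' = γ (w - x)`, `w' = (δ / γ) (y - w)`. Since `y` lies in `Ω` and `w` starts at `x₁`, a curve
pulled towards a closed convex set stays in it: first `w`, then `x`, and then `z`, which is a convex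
combination of `x` and `w` because `lam γ ≤ 1`.

Absorbing `lam` into the damping `a = α₁ - δ lam` turns the equation into `x'' + a x' = δ q` with `q
= y - z` and `‖q‖ ≤ α₀`. The Lyapunov function `‖x'‖²` gives `x' ∈ L²` and `x' → 0`
(`IsDampedSystem.velocity`). For a solution `p`, the energy `⟪x', x - p⟫ + (a / 2) ‖x - p‖²`
decreases up to an integrable error (`IsDampedSystem.distance`), so `‖x - p‖` converges and the
weighted gain `⟪U z, z - p⟫` has finite integral.

As `δ α₀` is not integrable, that gain comes arbitrarily close to `0` at arbitrarily late times. A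
cluster point `w` of `z` along such times satisfies `⟪U w, w - p⟫ ≤ 0`, hence is a solution by
paramonotonicity. Finally `‖x - w‖` converges and tends to `0` along a subsequence. -/

/-! ### Global solvability of ordinary differential equations -/

open scoped NNReal in
/-- **Global Picard–Lindelöf theorem** on a half-line, for a vector field that is locally uniformly
in time bounded and globally Lipschitz. -/
theorem exists_forall_hasDerivWithinAt_Ici {E : Type*} [NormedAddCommGroup E] [NormedSpace ℝ E]
    [CompleteSpace E] {f : ℝ → E → E} {t₀ : ℝ} (v₀ : E)
    (hcont : ∀ v, ContinuousOn (f · v) (Ici t₀))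
    (hlip : ∀ T, ∃ K : ℝ≥0, ∀ t ∈ Icc t₀ T, LipschitzWith K (f t))
    (hbdd : ∀ T, ∃ M : ℝ≥0, ∀ t ∈ Icc t₀ T, ∀ v, ‖f t v‖ ≤ M) :
    ∃ γ : ℝ → E, γ t₀ = v₀ ∧ ∀ t, t₀ ≤ t → HasDerivWithinAt γ (f t (γ t)) (Ici t₀) t := by
  have hloc : ∀ n : ℕ, ∃ g : ℝ → E, g t₀ = v₀ ∧
      ∀ t ∈ Icc t₀ (t₀ + n), HasDerivWithinAt g (f t (g t)) (Icc t₀ (t₀ + n)) t := by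
    intro n
    obtain ⟨K, hK⟩ := hlip (t₀ + n)
    obtain ⟨M, hM⟩ := hbdd (t₀ + n)
    -- A curve of speed at most `M` travels at most `M * n` in time `n`, so this radius gives
    -- existence on the whole interval.
    have hpl : IsPicardLindelof f (tmin := t₀) (tmax := t₀ + n) ⟨t₀, by simp⟩ v₀ (M * n) 0 M K :=
      { lipschitzOnWith := fun t ht => (hK t ht).lipschitzOnWith
        continuousOn := fun v _ => (hcont v).mono Icc_subset_Ici_self
        norm_le := fun t ht v _ => hM t ht v
        mul_max_le := by simp }
    exact hpl.exists_eq_forall_mem_Icc_hasDerivWithinAt₀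
  choose g hg₀ hg using hloc
  have huniq : ∀ (k n : ℕ) (t : ℝ), t₀ ≤ t → t ≤ t₀ + k → t ≤ t₀ + n → g k t = g n t := by
    intro k n t ht hk hn
    obtain ⟨K, hK⟩ := hlip t
    have hc : ∀ m : ℕ, t ≤ t₀ + m → ContinuousOn (g m) (Icc t₀ t) := fun m hm s hs =>
      ((hg m s ⟨hs.1, hs.2.trans hm⟩).continuousWithinAt).mono (Icc_subset_Icc_right hm)
    have hd : ∀ m : ℕ, t ≤ t₀ + m → ∀ s ∈ Ico t₀ t,
        HasDerivWithinAt (g m) (f s (g m s)) (Ici s) s := fun m hm s hs =>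
      (hg m s ⟨hs.1, hs.2.le.trans hm⟩).mono_of_mem_nhdsWithin
        (mem_of_superset (Icc_mem_nhdsGE (hs.2.trans_le hm)) (Icc_subset_Icc_left hs.1))
    exact ODE_solution_unique_of_mem_Icc_right (v := f) (s := fun _ => univ)
      (fun s hs => (hK s (Ico_subset_Icc_self hs)).lipschitzOnWith)
      (hc k hk) (hd k hk) (fun _ _ => mem_univ _) (hc n hn) (hd n hn) (fun _ _ => mem_univ _)
      ((hg₀ k).trans (hg₀ n).symm) ⟨ht, le_rfl⟩
  have hceil : ∀ t, t ≤ t₀ + ⌈t - t₀⌉₊ := fun t => by linarith [Nat.le_ceil (t - t₀)]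
  refine ⟨fun t => g ⌈t - t₀⌉₊ t, hg₀ _, fun t ht => ?_⟩
  -- The extra `1` makes `[t₀, t₀ + N]` a neighbourhood of `t` within `[t₀, ∞)`, even when `t - t₀`
  -- is an integer.
  set N := ⌈t - t₀⌉₊ + 1 with hN
  have htN : t < t₀ + N := by
    have := hceil t
    push_cast [hN]
    linarith
  have hmem : Icc t₀ (t₀ + N) ∈ 𝓝[Ici t₀] t := by
    rw [← Ici_inter_Iic]
    exact inter_mem_nhdsWithin _ (Iic_mem_nhds htN)
  have hval : ∀ s, t₀ ≤ s → s ≤ t₀ + N → g ⌈s - t₀⌉₊ s = g N s := fun s h1 h2 =>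
    huniq _ _ s h1 (hceil s) h2
  show HasDerivWithinAt _ (f t (g ⌈t - t₀⌉₊ t)) _ _
  rw [hval t ht htN.le]
  refine ((hg N t ⟨ht, htN.le⟩).mono_of_mem_nhdsWithin hmem).congr_of_eventuallyEq ?_ (hval t ht htN.le)
  filter_upwards [hmem] with s hs using hval s hs.1 hs.2

/-! ### Absolutely continuous functions -/

/-- An absolutely continuous function with almost everywhere nonpositive derivative decreases. -/
theorem AbsolutelyContinuousOnInterval.le_of_ae_deriv_nonpos {f : ℝ → ℝ} {a b : ℝ} (hab : a ≤ b)
    (hf : AbsolutelyContinuousOnInterval f a b)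
    (h : ∀ᵐ t ∂(volume.restrict (Icc a b)), deriv f t ≤ 0) : f b ≤ f a := by
  have h1 := hf.integral_deriv_eq_sub
  have h2 : 0 ≤ ∫ t in a..b, -deriv f t :=
    intervalIntegral.integral_nonneg_of_ae_restrict hab (h.mono fun t ht => by simpa using ht)
  rw [intervalIntegral.integral_neg] at h2
  linarith

/-- A function with continuous derivative on a compact interval is absolutely continuous. -/
theorem absolutelyContinuousOnInterval_of_hasDerivWithinAt {E : Type*} [NormedAddCommGroup E]
    [NormedSpace ℝ E] {f f' : ℝ → E} {a b : ℝ} (hab : a ≤ b)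
    (hf : ∀ t ∈ Icc a b, HasDerivWithinAt f (f' t) (Icc a b) t)
    (hf' : ContinuousOn f' (Icc a b)) : AbsolutelyContinuousOnInterval f a b := by
  obtain ⟨C, hC⟩ := isCompact_Icc.exists_bound_of_continuousOn hf'
  have hL : LipschitzOnWith C.toNNReal f (uIcc a b) := by
    rw [uIcc_of_le hab]
    refine (convex_Icc a b).lipschitzOnWith_of_nnnorm_hasDerivWithin_le hf fun t ht => ?_
    rw [← NNReal.coe_le_coe, coe_nnnorm]
    exact (hC t ht).trans (Real.le_coe_toNNReal C)
  exact hL.absolutelyContinuousOnInterval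

theorem LocallyACFrom.continuousOn {X : Type*} [SeminormedAddCommGroup X] {t₀ : ℝ} {f : ℝ → X}
    (hf : LocallyACFrom t₀ f) : ContinuousOn f (Ici t₀) := by
  intro t ht
  have h := (hf t₀ (t + 1) le_rfl (by linarith [mem_Ici.1 ht])).continuousOn
  rw [uIcc_of_le (by linarith [mem_Ici.1 ht])] at h
  refine (h t ⟨ht, by linarith⟩).mono_of_mem_nhdsWithin ?_
  rw [← Ici_inter_Iic]
  exact inter_mem_nhdsWithin _ (Iic_mem_nhds (lt_add_one t))

/-! ### The Riccati equation -/

/-- The Riccati vector field `v² - a v + d`, with `v` clamped to `[0, a / 2]`. -/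
noncomputable def clampedRiccati (a d v : ℝ) : ℝ :=
  d - max 0 (min v (a / 2)) * (a - max 0 (min v (a / 2)))

theorem clampedRiccati_of_mem {a d v : ℝ} (h0 : 0 ≤ v) (h1 : v ≤ a / 2) :
    clampedRiccati a d v = v ^ 2 + d - a * v := by
  rw [clampedRiccati, min_eq_left h1, max_eq_right h0]
  ring

theorem clampedRiccati_of_ge {a d v : ℝ} (ha : 0 ≤ a) (h1 : a / 2 ≤ v) :
    clampedRiccati a d v = d - a ^ 2 / 4 := by
  rw [clampedRiccati, min_eq_right h1, max_eq_right (by positivity)]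
  ring

/-- This linear lower bound lets an exponential serve as a barrier keeping the solution positive. -/
theorem neg_mul_le_clampedRiccati {a d v : ℝ} (ha : 0 ≤ a) (h0 : 0 ≤ v) :
    d - a * v ≤ clampedRiccati a d v := by
  rw [clampedRiccati]
  have h1 : max 0 (min v (a / 2)) ≤ v := max_le h0 (min_le_left _ _)
  have h2 : 0 ≤ max 0 (min v (a / 2)) := le_max_left _ _
  nlinarith

theorem abs_clampedRiccati_le {a d v : ℝ} (ha : 0 ≤ a) :
    |clampedRiccati a d v| ≤ |d| + a ^ 2 := by
  rw [clampedRiccati]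
  have h1 : max 0 (min v (a / 2)) ≤ a / 2 := max_le (by positivity) (min_le_right _ _)
  have h2 : 0 ≤ max 0 (min v (a / 2)) := le_max_left _ _
  refine (abs_sub _ _).trans (add_le_add_right ?_ _)
  rw [abs_of_nonneg (mul_nonneg h2 (by linarith))]
  nlinarith

/-- On `[0, a / 2]` the slope of `v (a - v)` lies between `0` and `a`, and clamping is 1-Lipschitz.
Clamping thus makes the quadratic field globally Lipschitz. -/
theorem abs_clampedRiccati_sub_le {a d v w : ℝ} (ha : 0 ≤ a) :
    |clampedRiccati a d v - clampedRiccati a d w| ≤ a * |v - w| := by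
  have key : |max 0 (min v (a / 2)) - max 0 (min w (a / 2))| ≤ |v - w| := by
    have h1 := abs_max_sub_max_le_max 0 (min v (a / 2)) 0 (min w (a / 2))
    have h2 := abs_min_sub_min_le_max v (a / 2) w (a / 2)
    simp only [sub_self, abs_zero, abs_nonneg, sup_of_le_left, sup_of_le_right] at h1 h2
    exact h1.trans h2
  rw [clampedRiccati, clampedRiccati]
  set p := max 0 (min v (a / 2))
  set q := max 0 (min w (a / 2))
  have hp0 : 0 ≤ p := le_max_left _ _
  have hq0 : 0 ≤ q := le_max_left _ _
  have hp1 : p ≤ a / 2 := max_le (by positivity) (min_le_right _ _)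
  have hq1 : q ≤ a / 2 := max_le (by positivity) (min_le_right _ _)
  have e : d - p * (a - p) - (d - q * (a - q)) = -((a - (p + q)) * (p - q)) := by ring
  rw [e, abs_neg, abs_mul, abs_of_nonneg (by linarith : 0 ≤ a - (p + q))]
  exact mul_le_mul (by linarith) key (abs_nonneg _) ha

/-- Under the coefficient conditions, the Riccati problem has a positive solution on
`[t₀, ∞)`. -/
theorem exists_isRiccatiSolution {t₀ : ℝ} {α₁ δ : ℝ → ℝ}
    (α₁_pos : ∀ t, t₀ ≤ t → 0 < α₁ t) (δ_pos : ∀ t, t₀ ≤ t → 0 < δ t)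
    (δ_lt : ∀ᵐ t ∂(volume.restrict (Ici t₀)), δ t < (α₁ t ^ 2 + 2 * deriv α₁ t) / 4)
    (α₁_ac : LocallyACFrom t₀ α₁) (δ_ac : LocallyACFrom t₀ δ) :
    ∃ γ, IsRiccatiSolution t₀ α₁ δ γ ∧ ∀ t, t₀ ≤ t → 0 < γ t := by
  have hα := α₁_ac.continuousOn
  have hδ := δ_ac.continuousOn
  have hbα : ∀ T, ∃ A, 0 < A ∧ ∀ t ∈ Icc t₀ T, α₁ t ≤ A := fun T => by
    obtain ⟨C, hC⟩ := isCompact_Icc.exists_bound_of_continuousOn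
      (hα.mono (Icc_subset_Ici_self : Icc t₀ T ⊆ _))
    exact ⟨max C 1, by positivity, fun t ht =>
      (le_abs_self _).trans ((hC t ht).trans (le_max_left _ _))⟩
  have hbδ : ∀ T, ∃ A, 0 ≤ A ∧ ∀ t ∈ Icc t₀ T, |δ t| ≤ A := fun T => by
    obtain ⟨C, hC⟩ := isCompact_Icc.exists_bound_of_continuousOn
      (hδ.mono (Icc_subset_Ici_self : Icc t₀ T ⊆ _))
    exact ⟨max C 0, by positivity, fun t ht => (hC t ht).trans (le_max_left _ _)⟩
  obtain ⟨γ, hγ₀, hγ⟩ := exists_forall_hasDerivWithinAt_Ici (t₀ := t₀)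
    (f := fun t v => clampedRiccati (α₁ t) (δ t) v) (α₁ t₀ / 4) (fun v => by
      unfold clampedRiccati
      fun_prop)
    (fun T => by
      obtain ⟨A, hA, hA'⟩ := hbα T
      refine ⟨A.toNNReal, fun t ht => LipschitzWith.of_dist_le_mul fun v w => ?_⟩
      rw [Real.dist_eq, Real.dist_eq, Real.coe_toNNReal _ hA.le]
      exact (abs_clampedRiccati_sub_le (α₁_pos t ht.1).le).trans
        (mul_le_mul_of_nonneg_right (hA' t ht) (abs_nonneg _)))
    (fun T => by
      obtain ⟨A, hA, hA'⟩ := hbα T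
      obtain ⟨B, hB, hB'⟩ := hbδ T
      refine ⟨(B + A ^ 2).toNNReal, fun t ht v => ?_⟩
      rw [Real.norm_eq_abs, Real.coe_toNNReal _ (by positivity)]
      exact (abs_clampedRiccati_le (α₁_pos t ht.1).le).trans
        (add_le_add (hB' t ht) (pow_le_pow_left₀ (α₁_pos t ht.1).le (hA' t ht) 2)))
  have hγc : ContinuousOn γ (Ici t₀) := fun t ht => (hγ t ht).continuousWithinAt
  have hpos : ∀ t, t₀ ≤ t → 0 < γ t := by
    intro T hT
    obtain ⟨A, hA, hA'⟩ := hbα T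
    set c := α₁ t₀ / 4
    have hc : 0 < c := by have := α₁_pos t₀ le_rfl; positivity
    have hB : ∀ s, HasDerivAt (fun s => -(c * Real.exp (-A * (s - t₀))))
        (A * (c * Real.exp (-A * (s - t₀)))) s := fun s => by
      have h := ((((hasDerivAt_id s).sub_const t₀).const_mul (-A)).exp.const_mul c).neg
      refine h.congr_deriv ?_
      simp only [id]
      ring
    -- Where `γ` meets the barrier `c exp (-A (s - t₀))`, its slope is at least `δ - α₁ γ`, which
    -- exceeds `-A γ` strictly because `δ > 0`.
    have h := image_le_of_deriv_right_lt_deriv_boundary' (f := fun s => -γ s) (a := t₀) (b := T)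
      (f' := fun s => -clampedRiccati (α₁ s) (δ s) (γ s))
      (B := fun s => -(c * Real.exp (-A * (s - t₀))))
      (B' := fun s => A * (c * Real.exp (-A * (s - t₀))))
      (hγc.neg.mono Icc_subset_Ici_self)
      (fun s hs => ((hγ s hs.1).mono (Ici_subset_Ici.2 hs.1)).neg)
      (by simp [hγ₀])
      (fun s _ => (hB s).continuousAt.continuousWithinAt)
      (fun s _ => (hB s).hasDerivWithinAt)
      (fun s hs he => by
        have he' : γ s = c * Real.exp (-A * (s - t₀)) := neg_injective he
        rw [← he']
        have hγs : 0 < γ s := he' ▸ by positivity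
        have h1 := neg_mul_le_clampedRiccati (d := δ s) (α₁_pos s hs.1).le hγs.le
        have h2 := δ_pos s hs.1
        have h3 := mul_le_mul_of_nonneg_right (hA' s (Ico_subset_Icc_self hs)) hγs.le
        linarith)
      ⟨hT, le_rfl⟩
    have : 0 < c * Real.exp (-A * (T - t₀)) := by positivity
    linarith
  have hle : ∀ t, t₀ ≤ t → γ t ≤ α₁ t / 2 := by
    intro T hT
    by_contra! hlt
    have hDc : ContinuousOn (fun s => γ s - α₁ s / 2) (Icc t₀ T) :=
      (hγc.sub (hα.div_const 2)).mono Icc_subset_Ici_self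
    set K := Icc t₀ T ∩ (fun s => γ s - α₁ s / 2) ⁻¹' Iic 0
    have hK : IsCompact K :=
      isCompact_Icc.of_isClosed_subset
        (hDc.preimage_isClosed_of_isClosed isClosed_Icc isClosed_Iic) inter_subset_left
    have hne : K.Nonempty := ⟨t₀, ⟨le_rfl, hT⟩, by
      have := α₁_pos t₀ le_rfl
      simp only [mem_preimage, mem_Iic, hγ₀]
      linarith⟩
    -- After the last time `s` at which `γ ≤ α₁ / 2`, the clamped field equals `δ - α₁² / 4`, so `γ
    -- - α₁ / 2` has derivative `δ - α₁² / 4 - α₁' / 2 < 0` almost everywhere and cannot become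
    -- positive. A pointwise barrier is unavailable, as `α₁` is only absolutely continuous.
    obtain ⟨s, ⟨⟨hs1, hs2⟩, hs3⟩, hs4⟩ := hK.exists_isGreatest hne
    simp only [mem_preimage, mem_Iic] at hs3
    have hst : s < T := lt_of_le_of_ne hs2 (by rintro rfl; linarith)
    have hgt : ∀ r ∈ Ioc s T, α₁ r / 2 < γ r := fun r hr => by
      by_contra! h
      exact hr.1.not_ge (hs4 ⟨⟨hs1.trans hr.1.le, hr.2⟩, by
        simp only [mem_preimage, mem_Iic]; linarith⟩)
    have hγac : AbsolutelyContinuousOnInterval γ s T := by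
      have hsub : Icc s T ⊆ Ici t₀ := fun r hr => hs1.trans hr.1
      refine absolutelyContinuousOnInterval_of_hasDerivWithinAt hs2
        (fun r hr => (hγ r (hs1.trans hr.1)).mono hsub) ?_
      have h1 := hα.mono hsub
      have h2 := hδ.mono hsub
      have h3 := hγc.mono hsub
      unfold clampedRiccati
      fun_prop
    have hDac : AbsolutelyContinuousOnInterval (fun r => γ r - 1 / 2 * α₁ r) s T :=
      hγac.fun_sub ((α₁_ac s T hs1 hs2).const_mul (1 / 2))
    have hae := (α₁_ac s T hs1 hs2).ae_differentiableAt
    have h := hDac.le_of_ae_deriv_nonpos hs2 (by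
      rw [← restrict_Ioo_eq_restrict_Icc, ae_restrict_iff' measurableSet_Ioo]
      rw [ae_restrict_iff' measurableSet_Ici] at δ_lt
      filter_upwards [hae, δ_lt] with r hr1 hr2 hr
      have hr0 : t₀ < r := hs1.trans_lt hr.1
      have hd := hr1 (by rw [uIcc_of_le hs2]; exact Ioo_subset_Icc_self hr)
      have hγr := (hγ r hr0.le).hasDerivAt (Ici_mem_nhds hr0)
      rw [(hγr.fun_sub (hd.hasDerivAt.const_mul (1 / 2))).deriv,
        clampedRiccati_of_ge (α₁_pos r hr0.le).le (hgt r (Ioo_subset_Ioc_self hr)).le]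
      linarith [hr2 hr0.le])
    linarith
  refine ⟨γ, ⟨hγ₀, fun t ht => ?_⟩, hpos⟩
  rw [← clampedRiccati_of_mem (hpos t ht).le (hle t ht)]
  exact hγ t ht

/-! ### Estimates for the projection step -/

section Projection

variable {E : Type*} [NormedAddCommGroup E] [InnerProductSpace ℝ E] [CompleteSpace E]
  {Ω : Set E} {U : E → E}

theorem inner_sub_metricProj_le_zero (hne : Ω.Nonempty) (hcl : IsClosed Ω) (hcv : Convex ℝ Ω)
    (z : E) {w : E} (hw : w ∈ Ω) : inner ℝ (z - metricProj Ω z) (w - metricProj Ω z) ≤ 0 := by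
  have hm := metricProj_mem hne hcl hcv z
  refine (norm_eq_iInf_iff_real_inner_le_zero hcv hm).1 ?_ w hw
  have : Nonempty Ω := ⟨⟨_, hm⟩⟩
  refine le_antisymm (le_ciInf fun w => ?_) ?_
  · simpa [dist_eq_norm] using dist_metricProj_le hne hcl hcv z w.2
  · exact ciInf_le (f := fun w : Ω => ‖z - w‖) ⟨0, by rintro _ ⟨w, rfl⟩; positivity⟩ ⟨_, hm⟩

/-- This is the obtuse-angle property of the projection of `z - s U z`, expanded around `z`. The
normalization ensures `s ‖U z‖ ≤ a`, which bounds the cross term by `a` times the length of the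
step. -/
theorem inner_projStep_sub_le (hne : Ω.Nonempty) (hcl : IsClosed Ω) (hcv : Convex ℝ Ω) {a : ℝ}
    (ha : 0 ≤ a) (z : E) {w : E} (hw : w ∈ Ω) :
    inner ℝ (projStep U Ω a z - z) (z - w) ≤
      a * ‖projStep U Ω a z - z‖ - ‖projStep U Ω a z - z‖ ^ 2
        - a / max 1 ‖U z‖ * inner ℝ (U z) (z - w) := by
  set s := a / max 1 ‖U z‖ with hs
  have hs0 : 0 ≤ s := by positivity
  have hsU : s * ‖U z‖ ≤ a := by
    rw [hs, div_mul_eq_mul_div]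
    exact div_le_of_le_mul₀ (by positivity) ha (mul_le_mul_of_nonneg_left (le_max_right _ _) ha)
  have h := inner_sub_metricProj_le_zero hne hcl hcv (z - s • U z) hw
  change inner ℝ (z - s • U z - projStep U Ω a z) (w - projStep U Ω a z) ≤ 0 at h
  set r := projStep U Ω a z - z with hr
  have hp : projStep U Ω a z = r + z := by rw [hr]; abel
  have e : inner ℝ (z - s • U z - projStep U Ω a z) (w - projStep U Ω a z)
      = inner ℝ r (z - w) + ‖r‖ ^ 2 + s * inner ℝ (U z) (z - w) + s * inner ℝ (U z) r := by
    have e1 : z - s • U z - projStep U Ω a z = -(r + s • U z) := by rw [hp]; abel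
    have e2 : w - projStep U Ω a z = -((z - w) + r) := by rw [hp]; abel
    rw [e1, e2, inner_neg_neg, inner_add_left, inner_add_right, inner_add_right,
      real_inner_smul_left, real_inner_smul_left, real_inner_self_eq_norm_sq]
    ring
  have h2 : -(s * inner ℝ (U z) r) ≤ a * ‖r‖ := by
    have h3 : -inner ℝ (U z) r ≤ ‖U z‖ * ‖r‖ :=
      (neg_le_abs _).trans (abs_real_inner_le_norm _ _)
    nlinarith [mul_le_mul_of_nonneg_left h3 hs0, mul_le_mul_of_nonneg_right hsU (norm_nonneg r)]
  linarith

/-- Taking `w = z` in the previous estimate is legitimate exactly because `z ∈ Ω`; hence the need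
for viability. -/
theorem norm_projStep_sub_le (hne : Ω.Nonempty) (hcl : IsClosed Ω) (hcv : Convex ℝ Ω) {a : ℝ}
    (ha : 0 ≤ a) {z : E} (hz : z ∈ Ω) : ‖projStep U Ω a z - z‖ ≤ a := by
  have h := inner_projStep_sub_le (U := U) hne hcl hcv ha z hz
  simp only [sub_self, inner_zero_right, mul_zero, sub_zero] at h
  nlinarith [norm_nonneg (projStep U Ω a z - z)]

end Projection

/-! ### Invariance of closed convex sets -/

section Invariance

variable {E : Type*} [NormedAddCommGroup E]

/-- A continuous function that lies almost everywhere in a closed set lies in it everywhere. -/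
theorem forall_mem_of_ae_mem_of_continuousOn {t₀ : ℝ} {y : ℝ → E} {Ω : Set E} (hcl : IsClosed Ω)
    (hy : ContinuousOn y (Ioi t₀)) (h : ∀ᵐ t ∂(volume.restrict (Ici t₀)), y t ∈ Ω) :
    ∀ t, t₀ < t → y t ∈ Ω := by
  have ho : IsOpen (Ioi t₀ ∩ y ⁻¹' Ωᶜ) := hy.isOpen_inter_preimage isOpen_Ioi hcl.isOpen_compl
  have h0 : volume (Ioi t₀ ∩ y ⁻¹' Ωᶜ) = 0 := by
    rw [ae_restrict_iff' measurableSet_Ici] at h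
    refine measure_mono_null ?_ (ae_iff.1 h)
    rintro t ⟨ht1, ht2⟩ h3
    exact ht2 (h3 (mem_Ici.2 (le_of_lt (mem_Ioi.1 ht1))))
  have h1 := (ho.measure_eq_zero_iff (μ := volume)).1 h0
  intro t ht
  by_contra hn
  exact (h1 ▸ (⟨ht, hn⟩ : t ∈ Ioi t₀ ∩ y ⁻¹' Ωᶜ) : t ∈ (∅ : Set ℝ))

/-- A curve whose velocity points towards a closed convex set never leaves it. -/
theorem forall_mem_of_hasDerivWithinAt_smul_sub [NormedSpace ℝ E] {Ω : Set E} (hcl : IsClosed Ω)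
    (hcv : Convex ℝ Ω) {t₀ : ℝ} {u u' y : ℝ → E} {c : ℝ → ℝ}
    (hu : ∀ t, t₀ ≤ t → HasDerivWithinAt u (u' t) (Ici t₀) t)
    (hu' : ∀ t, t₀ < t → u' t = c t • (y t - u t)) (hc : ∀ t, t₀ < t → 0 < c t)
    (hy : ∀ t, t₀ < t → y t ∈ Ω) (h₀ : u t₀ ∈ Ω) : ∀ t, t₀ ≤ t → u t ∈ Ω := by
  intro T hT
  by_contra hn
  -- A functional separating `u T` from `Ω` strictly decreases along `u` whenever it takes the value
  -- `s`, since `f (y t) < s`. So it can never pass that level.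
  obtain ⟨f, s, hfs, hs⟩ := geometric_hahn_banach_closed_point hcv hcl hn
  have h := image_le_of_deriv_right_lt_deriv_boundary' (f := fun t => f (u t)) (a := t₀) (b := T)
    (f' := fun t => f (u' t)) (B := fun _ => s) (B' := fun _ => 0)
    (fun t ht => (f.continuous.continuousAt.comp_continuousWithinAt
      (hu t ht.1).continuousWithinAt).mono Icc_subset_Ici_self)
    (fun t ht => f.hasFDerivAt.comp_hasDerivWithinAt t ((hu t ht.1).mono (Ici_subset_Ici.2 ht.1)))
    (hfs _ h₀).le continuousOn_const (fun t _ => hasDerivWithinAt_const _ _ _)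
    (fun t ht he => by
      have hlt : t₀ < t := lt_of_le_of_ne ht.1 (by
        rintro rfl
        exact (hfs _ h₀).ne he)
      rw [hu' t hlt, map_smul, map_sub, he, smul_eq_mul]
      exact mul_neg_of_pos_of_neg (hc t hlt) (sub_neg.2 (hfs _ (hy t hlt))))
    ⟨hT, le_rfl⟩
  exact hs.not_ge h

end Invariance

/-! ### Viability of the trajectory -/

section Solution

variable {E : Type*} [NormedAddCommGroup E] [InnerProductSpace ℝ E]
  {U : E → E} {Ω : Set E} {t₀ : ℝ} {α₀ α₁ δ lam : ℝ → ℝ} {x₀ x₁ : E} {x x' x'' : ℝ → E}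

theorem IsStrongGlobalSolution.continuousOn''
    (hx : IsStrongGlobalSolution U Ω t₀ α₀ α₁ δ lam x₀ x₁ x x' x'') :
    ContinuousOn x'' (Ioi t₀) := by
  intro t (ht : t₀ < t)
  have h := (hx.ac'' ((t₀ + t) / 2) (t + 1) (by linarith) (by linarith)).continuousOn
  rw [uIcc_of_le (by linarith)] at h
  exact (h.continuousAt (Icc_mem_nhds (by linarith) (by linarith))).continuousWithinAt

/-- The trajectory `x` and its extrapolation `x + lam x'` stay in `Ω`. -/
theorem IsStrongGlobalSolution.add_smul_mem [CompleteSpace E] (hne : Ω.Nonempty)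
    (hcl : IsClosed Ω) (hcv : Convex ℝ Ω) (hcoef : CoefficientConditions t₀ α₀ α₁ δ lam)
    (hx₀ : x₀ ∈ Ω) (hx₁ : x₁ ∈ Ω)
    (hx : IsStrongGlobalSolution U Ω t₀ α₀ α₁ δ lam x₀ x₁ x x' x'') :
    ∀ t, t₀ ≤ t → x t + lam t • x' t ∈ Ω := by
  obtain ⟨γ, hγ, hγpos⟩ := exists_isRiccatiSolution hcoef.α₁_pos hcoef.δ_pos hcoef.δ_lt
    hcoef.α₁_ac hcoef.δ_ac
  have hα := hcoef.α₁_ac.continuousOn.mono Ioi_subset_Ici_self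
  have hδ := hcoef.δ_ac.continuousOn.mono Ioi_subset_Ici_self
  have hxc : ContinuousOn x (Ioi t₀) := fun t ht =>
    (hx.hasDeriv t (le_of_lt ht)).continuousWithinAt.mono Ioi_subset_Ici_self
  have hxc' : ContinuousOn x' (Ioi t₀) := fun t ht =>
    (hx.hasDeriv' t (le_of_lt ht)).continuousWithinAt.mono Ioi_subset_Ici_self
  -- Solving the equation for `y` gives a continuous function that equals the projection step almost
  -- everywhere. It therefore lies in `Ω` at every `t > t₀`, and the flow identities below have no
  -- exceptional null set.
  set y : ℝ → E := fun t => x t + (δ t)⁻¹ • (x'' t + α₁ t • x' t) with hy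
  have hymem : ∀ t, t₀ < t → y t ∈ Ω := by
    refine forall_mem_of_ae_mem_of_continuousOn hcl ?_ ?_
    · exact hxc.add ((hδ.inv₀ fun t ht => (hcoef.δ_pos t (le_of_lt ht)).ne').smul
        (hx.continuousOn''.add (hα.smul hxc')))
    · filter_upwards [hx.equation, ae_restrict_mem measurableSet_Ici] with t ht htm
      rw [hy]
      simp only
      rw [ht, inv_smul_smul₀ (hcoef.δ_pos t htm).ne', add_sub_cancel]
      exact metricProj_mem hne hcl hcv _
  -- The Riccati equation is what cancels the remaining `x'` terms in `w'`, leaving `(δ / γ) (y -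
  -- w)`.
  set w : ℝ → E := fun t => x t + (γ t)⁻¹ • x' t with hw
  have hwmem : ∀ t, t₀ ≤ t → w t ∈ Ω := by
    refine forall_mem_of_hasDerivWithinAt_smul_sub hcl hcv (y := y) (c := fun t => δ t / γ t)
      (fun t ht => (hx.hasDeriv t ht).add
        (((hγ.2 t ht).fun_inv (hγpos t ht).ne').smul (hx.hasDeriv' t ht)))
      (fun t ht => ?_) (fun t ht => div_pos (hcoef.δ_pos t ht.le) (hγpos t ht.le)) hymem ?_
    · have h1 := (hγpos t ht.le).ne'
      have h2 := (hcoef.δ_pos t ht.le).ne'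
      simp only [hy, hw]
      match_scalars <;> field_simp <;> ring
    · have h1 := (hcoef.α₁_pos t₀ le_rfl).ne'
      have : w t₀ = x₁ := by
        simp only [hw, hγ.1, hx.init, hx.init']
        rw [inv_smul_smul₀ (by positivity), add_sub_cancel]
      rwa [this]
  have hxmem : ∀ t, t₀ ≤ t → x t ∈ Ω := by
    refine forall_mem_of_hasDerivWithinAt_smul_sub hcl hcv (y := w) (c := γ) hx.hasDeriv
      (fun t ht => ?_) (fun t ht => hγpos t ht.le) (fun t ht => hwmem t ht.le) (hx.init ▸ hx₀)
    simp only [hw]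
    rw [add_sub_cancel_left, smul_inv_smul₀ (hγpos t ht.le).ne']
  intro t ht
  have h1 := hcoef.lam_mul_riccati_le γ hγ t ht
  have h2 := hcoef.lam_nonneg t ht
  have h3 := hγpos t ht
  have e : x t + lam t • x' t = (1 - lam t * γ t) • x t + (lam t * γ t) • w t := by
    simp only [hw]
    match_scalars
    · field_simp
      ring
    · field_simp
  rw [e]
  exact hcv (hxmem t ht) (hwmem t ht) (by linarith) (by positivity) (by ring)

end Solution

/-! ### Convergence and integrability on a half-line -/

theorem AntitoneOn.exists_tendsto_atTop {f : ℝ → ℝ} {T m : ℝ} (hf : AntitoneOn f (Ici T))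
    (hm : ∀ t, T ≤ t → m ≤ f t) : ∃ l, m ≤ l ∧ Tendsto f atTop (𝓝 l) := by
  have h1 : Antitone fun t => f (max t T) := fun s t hst =>
    hf (mem_Ici.2 (le_max_right _ _)) (mem_Ici.2 (le_max_right _ _)) (max_le_max_right _ hst)
  have h2 : BddBelow (range fun t => f (max t T)) :=
    ⟨m, by rintro _ ⟨t, rfl⟩; exact hm _ (le_max_right _ _)⟩
  refine ⟨_, le_ciInf fun t => hm _ (le_max_right _ _), (tendsto_atTop_ciInf h1 h2).congr' ?_⟩
  filter_upwards [eventually_ge_atTop T] with t ht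
  rw [max_eq_left ht]

theorem AbsolutelyContinuousOnInterval.sub_le_integral {F g : ℝ → ℝ} {a b : ℝ} (hab : a ≤ b)
    (hF : AbsolutelyContinuousOnInterval F a b)
    (h : ∀ᵐ t ∂(volume.restrict (Icc a b)), deriv F t ≤ g t) (hg : IntegrableOn g (Icc a b)) :
    F b - F a ≤ ∫ t in a..b, g t := by
  rw [← hF.integral_deriv_eq_sub]
  exact intervalIntegral.integral_mono_ae_restrict hab hF.intervalIntegrable_deriv
    ((intervalIntegrable_iff_integrableOn_Icc_of_le hab).2 hg) h

section HalfLine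

variable {F g : ℝ → ℝ} {T : ℝ}

theorem intervalIntegral_le_setIntegral_abs (hg : IntegrableOn g (Ici T)) {t : ℝ} (ht : T ≤ t) :
    ∫ s in T..t, g s ≤ ∫ s in Ici T, |g s| := by
  have hsub : Ioc T t ⊆ Ici T := fun s hs => hs.1.le
  rw [intervalIntegral.integral_of_le ht]
  exact (setIntegral_mono (hg.mono_set hsub) (hg.mono_set hsub).abs fun _ => le_abs_self _).trans
    (setIntegral_mono_set hg.abs (Eventually.of_forall fun _ => abs_nonneg _)
      (Eventually.of_forall hsub))

/-- A function that is bounded below and whose derivative is bounded above by an integrable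
function converges at infinity. -/
theorem exists_tendsto_of_ae_deriv_le {m : ℝ} (hF : LocallyACFrom T F)
    (h : ∀ᵐ t ∂(volume.restrict (Ici T)), deriv F t ≤ g t) (hg : IntegrableOn g (Ici T))
    (hm : ∀ t, T ≤ t → m ≤ F t) : ∃ l, Tendsto F atTop (𝓝 l) := by
  have hgi : ∀ a b, T ≤ a → a ≤ b → IntervalIntegrable g volume a b := fun a b ha hab =>
    (intervalIntegrable_iff_integrableOn_Icc_of_le hab).2
      (hg.mono_set fun t ht => ha.trans ht.1)
  have hlim : Tendsto (fun t => ∫ s in T..t, g s) atTop (𝓝 (∫ s in Ioi T, g s)) :=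
    intervalIntegral_tendsto_integral_Ioi T (hg.mono_set Ioi_subset_Ici_self) tendsto_id
  have hanti : AntitoneOn (fun t => F t - ∫ s in T..t, g s) (Ici T) := by
    intro a ha b _ hab
    have h1 := (hF a b ha hab).sub_le_integral hab
      (ae_restrict_of_ae_restrict_of_subset (fun t ht => le_trans ha ht.1) h)
      (hg.mono_set fun t ht => le_trans ha ht.1)
    have h2 := intervalIntegral.integral_add_adjacent_intervals (hgi T a le_rfl ha)
      (hgi a b ha hab)
    simp only
    linarith
  have hbound : ∀ t, T ≤ t → ∫ s in T..t, g s ≤ ∫ s in Ici T, |g s| := fun t ht =>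
    intervalIntegral_le_setIntegral_abs hg ht
  obtain ⟨l, -, hl⟩ := hanti.exists_tendsto_atTop (m := m - ∫ s in Ici T, |g s|) fun t ht => by
    linarith [hm t ht, hbound t ht]
  exact ⟨_, (hl.add hlim).congr fun t => by ring⟩

/-- If `F` is bounded below and `F' ≤ g - k` with `g` integrable and `k` nonnegative, then `k` is
integrable. -/
theorem integrableOn_of_ae_deriv_le_sub {k : ℝ → ℝ} {m : ℝ} (hF : LocallyACFrom T F)
    (h : ∀ᵐ t ∂(volume.restrict (Ici T)), deriv F t ≤ g t - k t) (hg : IntegrableOn g (Ici T))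
    (hk : LocallyIntegrableOn k (Ici T)) (hk0 : ∀ t, T ≤ t → 0 ≤ k t)
    (hm : ∀ t, T ≤ t → m ≤ F t) : IntegrableOn k (Ici T) := by
  have hki : ∀ t, IntegrableOn k (Icc T t) := fun t =>
    hk.integrableOn_compact_subset Icc_subset_Ici_self isCompact_Icc
  rw [integrableOn_Ici_iff_integrableOn_Ioi]
  refine integrableOn_Ioi_of_intervalIntegral_norm_bounded (F T - m + ∫ s in Ici T, |g s|) T
    (fun t => (hki t).mono_set Ioc_subset_Icc_self) tendsto_id ?_
  filter_upwards [eventually_ge_atTop T] with t ht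
  have hsub : Icc T t ⊆ Ici T := Icc_subset_Ici_self
  have h1 := (hF T t le_rfl ht).sub_le_integral ht
    (ae_restrict_of_ae_restrict_of_subset hsub h) ((hg.mono_set hsub).sub (hki t))
  rw [intervalIntegral.integral_sub
    ((intervalIntegrable_iff_integrableOn_Icc_of_le ht).2 (hg.mono_set hsub))
    ((intervalIntegrable_iff_integrableOn_Icc_of_le ht).2 (hki t))] at h1
  have h2 : ∫ s in T..t, ‖k s‖ = ∫ s in T..t, k s := by
    refine intervalIntegral.integral_congr fun s hs => ?_
    rw [uIcc_of_le ht] at hs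
    exact abs_of_nonneg (hk0 s hs.1)
  have h3 : ∫ s in T..t, g s ≤ ∫ s in Ici T, |g s| := intervalIntegral_le_setIntegral_abs hg ht
  have h4 := hm t ht
  linarith

theorem eq_zero_of_tendsto_of_integrableOn_Ici {l : ℝ} (hg : IntegrableOn g (Ici T))
    (hl : Tendsto g atTop (𝓝 l)) : l = 0 := by
  by_contra hne
  have h1 : ∀ᶠ t in atTop, |l| / 2 < |g t| :=
    hl.abs.eventually (lt_mem_nhds (half_lt_self (abs_pos.2 hne)))
  obtain ⟨N, hN⟩ := eventually_atTop.1 h1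
  have h2 : IntegrableOn (fun _ => |l| / 2) (Ici (max N T)) := by
    refine Integrable.mono' (hg.mono_set (Ici_subset_Ici.2 (le_max_right _ _))).abs
      aestronglyMeasurable_const ?_
    filter_upwards [ae_restrict_mem measurableSet_Ici] with t ht
    rw [Real.norm_eq_abs, abs_of_nonneg (by positivity)]
    exact (hN t ((le_max_left _ _).trans ht)).le
  rw [integrableOn_const_iff] at h2
  simp [hne] at h2

end HalfLine

/-! ### Energy estimates for the damped system -/

/-- The second-order system `x'' + a x' = δ q` on `[T, ∞)` with a forcing term of size at most
`α₀`, nonincreasing damping `a`, and `δ α₀²` integrable. -/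
structure IsDampedSystem {E : Type*} [NormedAddCommGroup E] [InnerProductSpace ℝ E]
    (T C₁ C₂ : ℝ) (α₀ a δ : ℝ → ℝ) (x x' x'' q : ℝ → E) : Prop where
  C₁_pos : 0 < C₁
  C₂_pos : 0 < C₂
  δ_nonneg : ∀ t, T ≤ t → 0 ≤ δ t
  damping : ∀ t, T ≤ t → C₁ + C₂ * δ t ≤ 2 * a t
  a_ac : LocallyACFrom T a
  deriv_nonpos : ∀ᵐ t ∂(volume.restrict (Ici T)), deriv a t ≤ 0
  integrable : IntegrableOn (fun t => δ t * α₀ t ^ 2) (Ici T)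
  hasDeriv : ∀ t, T ≤ t → HasDerivAt x (x' t) t
  hasDeriv' : ∀ t, T ≤ t → HasDerivAt x' (x'' t) t
  continuousOn'' : ContinuousOn x'' (Ici T)
  equation : ∀ᵐ t ∂(volume.restrict (Ici T)), x'' t + a t • x' t = δ t • q t
  norm_le : ∀ᵐ t ∂(volume.restrict (Ici T)), ‖q t‖ ≤ α₀ t

namespace IsDampedSystem

variable {E : Type*} [NormedAddCommGroup E] [InnerProductSpace ℝ E]
  {T C₁ C₂ : ℝ} {α₀ a δ : ℝ → ℝ} {x x' x'' q : ℝ → E}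

variable (h : IsDampedSystem T C₁ C₂ α₀ a δ x x' x'' q)
include h

theorem continuousOn : ContinuousOn x (Ici T) := fun t ht =>
  (h.hasDeriv t ht).continuousAt.continuousWithinAt

theorem continuousOn' : ContinuousOn x' (Ici T) := fun t ht =>
  (h.hasDeriv' t ht).continuousAt.continuousWithinAt

theorem half_C₁_le (t : ℝ) (ht : T ≤ t) : C₁ / 2 ≤ a t := by
  have h1 := h.damping t ht
  have h2 := mul_nonneg h.C₂_pos.le (h.δ_nonneg t ht)
  linarith

theorem antitoneOn : AntitoneOn a (Ici T) := fun s hs t _ hst =>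
  (h.a_ac s t hs hst).le_of_ae_deriv_nonpos hst
    (ae_restrict_of_ae_restrict_of_subset (fun _ hr => le_trans hs hr.1) h.deriv_nonpos)

theorem δ_le (t : ℝ) (ht : T ≤ t) : δ t ≤ 2 * a T / C₂ := by
  have h1 := h.damping t ht
  have h2 := h.antitoneOn self_mem_Ici ht ht
  rw [le_div_iff₀ h.C₂_pos]
  linarith [h.C₁_pos]

/-- In the derivative of `‖x'‖²`, Young's inequality with weight `C₂` bounds the forcing by `C₂⁻¹ δ
α₀² + C₂ δ ‖x'‖²`. The damping condition absorbs the second term and leaves `-C₁ ‖x'‖²`. -/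
theorem velocity : IntegrableOn (fun t => ‖x' t‖ ^ 2) (Ici T) ∧ Tendsto x' atTop (𝓝 0) := by
  have hC₁ := h.C₁_pos
  have hC₂ := h.C₂_pos
  have hd : ∀ t, T ≤ t → HasDerivAt (fun t => ‖x' t‖ ^ 2) (2 * inner ℝ (x' t) (x'' t)) t :=
    fun t ht => (h.hasDeriv' t ht).norm_sq
  have hc := h.continuousOn'
  have hc'' := h.continuousOn''
  have hac : LocallyACFrom T fun t => ‖x' t‖ ^ 2 := fun b c hb hbc => by
    have hsub : Icc b c ⊆ Ici T := fun t ht => hb.trans ht.1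
    refine absolutelyContinuousOnInterval_of_hasDerivWithinAt hbc
      (fun t ht => (hd t (hsub ht)).hasDerivWithinAt) ?_
    exact continuousOn_const.mul ((hc.mono hsub).inner (hc''.mono hsub))
  have hae : ∀ᵐ t ∂(volume.restrict (Ici T)),
      deriv (fun t => ‖x' t‖ ^ 2) t ≤ C₂⁻¹ * (δ t * α₀ t ^ 2) - C₁ * ‖x' t‖ ^ 2 := by
    filter_upwards [h.equation, h.norm_le, ae_restrict_mem measurableSet_Ici] with t h1 h2 ht
    rw [(hd t ht).deriv, eq_sub_of_add_eq h1, inner_sub_right, real_inner_smul_right,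
      real_inner_smul_right, real_inner_self_eq_norm_sq]
    have h3 : inner ℝ (x' t) (q t) ≤ ‖x' t‖ * α₀ t :=
      (real_inner_le_norm _ _).trans (mul_le_mul_of_nonneg_left h2 (norm_nonneg _))
    have h4 : 2 * (‖x' t‖ * α₀ t) ≤ C₂⁻¹ * α₀ t ^ 2 + C₂ * ‖x' t‖ ^ 2 := by
      have e : C₂⁻¹ * α₀ t ^ 2 + C₂ * ‖x' t‖ ^ 2 - 2 * (‖x' t‖ * α₀ t)
          = C₂⁻¹ * (α₀ t - C₂ * ‖x' t‖) ^ 2 := by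
        field_simp
        ring
      have : 0 ≤ C₂⁻¹ * (α₀ t - C₂ * ‖x' t‖) ^ 2 := by positivity
      linarith
    have hδ := h.δ_nonneg t ht
    nlinarith [mul_le_mul_of_nonneg_left h3 hδ, mul_le_mul_of_nonneg_left h4 hδ,
      mul_le_mul_of_nonneg_right (h.damping t ht) (sq_nonneg ‖x' t‖)]
  have hg := h.integrable.const_mul C₂⁻¹
  have hint := integrableOn_of_ae_deriv_le_sub (m := 0) hac hae hg
    ((continuousOn_const.mul (hc.norm.pow 2)).locallyIntegrableOn measurableSet_Ici)
    (fun t _ => by positivity) (fun t _ => by positivity)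
  have hint' : IntegrableOn (fun t => ‖x' t‖ ^ 2) (Ici T) := by
    have := hint.const_mul C₁⁻¹
    simp only [inv_mul_cancel_left₀ hC₁.ne'] at this
    exact this
  obtain ⟨l, hl⟩ := exists_tendsto_of_ae_deriv_le (m := 0) hac (hae.mono fun t ht => ht.trans
    (sub_le_self _ (by positivity))) hg (fun t _ => by positivity)
  refine ⟨hint', ?_⟩
  rw [eq_zero_of_tendsto_of_integrableOn_Ici hint' hl] at hl
  rw [tendsto_zero_iff_norm_tendsto_zero]
  simpa [Real.sqrt_sq (norm_nonneg _)] using hl.sqrt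

/-- Energy estimate: if the forcing points towards `p` up to an integrable error, then the
distance to `p` converges, and the strict gain `k` is integrable. -/
theorem distance {lam k : ℝ → ℝ} {L : ℝ} (hlam : ∀ t, T ≤ t → |lam t| ≤ L)
    (hv : ∀ t, T ≤ t → ‖x' t‖ ≤ 1) (p : E) (hk : LocallyIntegrableOn k (Ici T))
    (hk0 : ∀ t, T ≤ t → 0 ≤ k t)
    (hq : ∀ᵐ t ∂(volume.restrict (Ici T)),
      δ t * inner ℝ (q t) (x t + lam t • x' t - p) ≤ δ t * α₀ t ^ 2 - k t) :
    IntegrableOn k (Ici T) ∧ ∃ r, Tendsto (fun t => ‖x t - p‖) atTop (𝓝 r) := by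
  have hC₁ := h.C₁_pos
  have hL : 0 ≤ L := (abs_nonneg _).trans (hlam T le_rfl)
  obtain ⟨hvint, hv0⟩ := h.velocity
  set D := 2 * a T / C₂
  have hD : ∀ t, T ≤ t → δ t ≤ D := h.δ_le
  have hc := h.continuousOn
  have hc' := h.continuousOn'
  have hc'' := h.continuousOn''
  -- The energy is `I + a H` with `I = H'`. Its derivative is `‖x'‖² + δ ⟪q, x - p⟫ + a' H` almost
  -- everywhere, and the last term is dropped since `a' ≤ 0`.
  set H : ℝ → ℝ := fun t => 2⁻¹ * ‖x t - p‖ ^ 2 with hH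
  set I : ℝ → ℝ := fun t => inner ℝ (x' t) (x t - p) with hI
  have hdH : ∀ t, T ≤ t → HasDerivAt H (I t) t := fun t ht => by
    refine (((h.hasDeriv t ht).sub_const p).norm_sq.const_mul 2⁻¹).congr_deriv ?_
    rw [hI, real_inner_comm]
    ring
  have hdI : ∀ t, T ≤ t →
      HasDerivAt I (inner ℝ (x' t) (x' t) + inner ℝ (x'' t) (x t - p)) t := fun t ht =>
    (h.hasDeriv' t ht).inner ℝ ((h.hasDeriv t ht).sub_const p)
  have hacH : LocallyACFrom T H := fun b c hb hbc => by
    have hsub : Icc b c ⊆ Ici T := fun t ht => hb.trans ht.1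
    refine absolutelyContinuousOnInterval_of_hasDerivWithinAt hbc
      (fun t ht => (hdH t (hsub ht)).hasDerivWithinAt) ?_
    exact (hc'.mono hsub).inner ((hc.mono hsub).sub continuousOn_const)
  have hacI : LocallyACFrom T I := fun b c hb hbc => by
    have hsub : Icc b c ⊆ Ici T := fun t ht => hb.trans ht.1
    refine absolutelyContinuousOnInterval_of_hasDerivWithinAt hbc
      (fun t ht => (hdI t (hsub ht)).hasDerivWithinAt) ?_
    exact ((hc'.mono hsub).inner (hc'.mono hsub)).add
      ((hc''.mono hsub).inner ((hc.mono hsub).sub continuousOn_const))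
  have hacF : LocallyACFrom T fun t => I t + a t * H t := fun b c hb hbc =>
    (hacI b c hb hbc).fun_add ((h.a_ac b c hb hbc).fun_mul (hacH b c hb hbc))
  have hadiff : ∀ᵐ t ∂(volume.restrict (Ici T)), t ≠ T → DifferentiableAt ℝ a t := by
    have h1 : ∀ᵐ t, ∀ n : ℕ, t ∈ uIcc T (T + n) → DifferentiableAt ℝ a t :=
      ae_all_iff.2 fun n => (h.a_ac T (T + n) le_rfl (by simp)).ae_differentiableAt
    filter_upwards [ae_restrict_of_ae h1, ae_restrict_mem measurableSet_Ici] with t ht htT _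
    obtain ⟨n, hn⟩ := exists_nat_ge (t - T)
    refine ht n ?_
    rw [uIcc_of_le (by simp)]
    exact ⟨htT, by linarith⟩
  have hae : ∀ᵐ t ∂(volume.restrict (Ici T)), deriv (fun t => I t + a t * H t) t ≤
      ((1 + D / 2) * ‖x' t‖ ^ 2 + (1 + L ^ 2 / 2) * (δ t * α₀ t ^ 2)) - k t := by
    filter_upwards [h.equation, h.norm_le, hadiff, h.deriv_nonpos, hq,
      ae_restrict_mem measurableSet_Ici,
      ae_restrict_of_ae (Measure.ae_ne volume T)] with t h1 h2 h3 h4 h5 ht hne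
    rw [((hdI t ht).fun_add ((h3 hne).hasDerivAt.fun_mul (hdH t ht))).deriv,
      eq_sub_of_add_eq h1, inner_sub_left, real_inner_smul_left, real_inner_smul_left,
      real_inner_self_eq_norm_sq]
    have h6 : inner ℝ (q t) (x t + lam t • x' t - p) =
        inner ℝ (q t) (x t - p) + lam t * inner ℝ (q t) (x' t) := by
      rw [add_sub_right_comm, inner_add_right, real_inner_smul_right]
    rw [h6] at h5
    have h7 : -(lam t * inner ℝ (q t) (x' t)) ≤ L * (α₀ t * ‖x' t‖) := by
      refine (neg_le_abs _).trans ?_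
      rw [abs_mul]
      exact mul_le_mul (hlam t ht) ((abs_real_inner_le_norm _ _).trans
        (mul_le_mul_of_nonneg_right h2 (norm_nonneg _))) (abs_nonneg _) hL
    have h8 : L * (α₀ t * ‖x' t‖) ≤ L ^ 2 / 2 * α₀ t ^ 2 + 1 / 2 * ‖x' t‖ ^ 2 := by
      nlinarith [sq_nonneg (L * α₀ t - ‖x' t‖)]
    have hδ := h.δ_nonneg t ht
    have h9 := mul_le_mul_of_nonneg_left (h7.trans h8) hδ
    have h10 := mul_le_mul_of_nonneg_right (hD t ht) (sq_nonneg ‖x' t‖)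
    have h11 : deriv a t * H t ≤ 0 := mul_nonpos_of_nonpos_of_nonneg h4 (by positivity)
    simp only [hI]
    nlinarith
  have hg := (hvint.const_mul (1 + D / 2)).add (h.integrable.const_mul (1 + L ^ 2 / 2))
  have hIr : ∀ t, T ≤ t → |I t| ≤ ‖x' t‖ * ‖x t - p‖ := fun t _ => abs_real_inner_le_norm _ _
  -- This quadratic in `‖x t - p‖` bounds the energy below by its minimum `-1 / C₁`, and later turns
  -- an upper bound for the energy into one for the distance.
  have hlow : ∀ t, T ≤ t → C₁ / 4 * ‖x t - p‖ ^ 2 - ‖x t - p‖ ≤ I t + a t * H t := fun t ht => by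
    have h1 := (abs_le.1 (hIr t ht)).1
    have h2 := mul_le_mul_of_nonneg_right (hv t ht) (norm_nonneg (x t - p))
    have h3 := mul_le_mul_of_nonneg_right (h.half_C₁_le t ht) (by positivity : 0 ≤ H t)
    simp only [hH] at h3 ⊢
    linarith
  have hm : ∀ t, T ≤ t → -C₁⁻¹ ≤ I t + a t * H t := fun t ht => by
    refine le_trans ?_ (hlow t ht)
    have e : C₁ / 4 * ‖x t - p‖ ^ 2 - ‖x t - p‖ - -C₁⁻¹
        = C₁⁻¹ * (C₁ / 2 * ‖x t - p‖ - 1) ^ 2 := by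
      field_simp
      ring
    have : 0 ≤ C₁⁻¹ * (C₁ / 2 * ‖x t - p‖ - 1) ^ 2 := by positivity
    linarith
  refine ⟨integrableOn_of_ae_deriv_le_sub hacF hae hg hk hk0 hm, ?_⟩
  obtain ⟨l, hl⟩ := exists_tendsto_of_ae_deriv_le hacF (by
    filter_upwards [hae, ae_restrict_mem measurableSet_Ici] with t h1 ht
    exact h1.trans (sub_le_self _ (hk0 t ht))) hg hm
  set R := 1 + 4 * (|l + 1| + 1) / C₁
  have hbd : ∀ᶠ t in atTop, ‖x t - p‖ ≤ R := by
    filter_upwards [hl.eventually (gt_mem_nhds (lt_add_one l)), eventually_ge_atTop T] with t h1 ht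
    have h2 := hlow t ht
    by_contra! hlt
    have h3 : 4 * (|l + 1| + 1) / C₁ < ‖x t - p‖ := by linarith
    have h4 : 1 < ‖x t - p‖ := by
      have : 0 ≤ 4 * (|l + 1| + 1) / C₁ := by positivity
      linarith
    rw [div_lt_iff₀ hC₁] at h3
    nlinarith [le_abs_self (l + 1), abs_nonneg (l + 1), norm_nonneg (x t - p)]
  have hI0 : Tendsto I atTop (𝓝 0) := by
    rw [tendsto_zero_iff_abs_tendsto_zero]
    have h1 : Tendsto (fun t => ‖x' t‖ * R) atTop (𝓝 0) := by
      simpa using (tendsto_zero_iff_norm_tendsto_zero.1 hv0).mul_const R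
    refine squeeze_zero' (Eventually.of_forall fun _ => abs_nonneg _) ?_ h1
    filter_upwards [hbd, eventually_ge_atTop T] with t h2 ht
    exact (hIr t ht).trans (mul_le_mul_of_nonneg_left h2 (norm_nonneg _))
  -- The damping has a positive limit, so `H = (I + a H - I) / a` inherits convergence from the
  -- energy and `I → 0`.
  obtain ⟨b, hb, hab⟩ := h.antitoneOn.exists_tendsto_atTop h.half_C₁_le
  have hb0 : b ≠ 0 := ((half_pos hC₁).trans_le hb).ne'
  have h1 : Tendsto (fun t => 2 * ((I t + a t * H t - I t) / a t)) atTop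
      (𝓝 (2 * ((l - 0) / b))) := ((hl.sub hI0).div hab hb0).const_mul 2
  refine ⟨_, h1.sqrt.congr' ?_⟩
  filter_upwards [eventually_ge_atTop T] with t ht
  have h2 : a t ≠ 0 := ((half_pos hC₁).trans_le (h.half_C₁_le t ht)).ne'
  rw [add_sub_cancel_left, mul_div_cancel_left₀ _ h2, hH]
  simp only
  rw [mul_inv_cancel_left₀ two_ne_zero, Real.sqrt_sq (norm_nonneg _)]

end IsDampedSystem

/-! ### Integrability of the coefficients -/

section Coefficients

variable {t₀ : ℝ} {α₀ α₁ δ lam : ℝ → ℝ}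

theorem CoefficientConditions.locallyIntegrableOn_mul
    (h : CoefficientConditions t₀ α₀ α₁ δ lam) :
    LocallyIntegrableOn (fun t => δ t * α₀ t) (Ici t₀) :=
  h.α₀_locInt.continuousOn_mul h.δ_ac.continuousOn isLocallyClosed_Ici

theorem CoefficientConditions.integrableOn_mul_sq (h : CoefficientConditions t₀ α₀ α₁ δ lam) :
    IntegrableOn (fun t => δ t * α₀ t ^ 2) (Ici t₀) := by
  have h1 : AEStronglyMeasurable (fun t => δ t * α₀ t ^ 2) (volume.restrict (Ici t₀)) :=
    (h.δ_ac.continuousOn.aestronglyMeasurable measurableSet_Ici).mul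
      (h.α₀_locInt.aestronglyMeasurable.pow 2)
  refine ⟨h1, ?_⟩
  rw [hasFiniteIntegral_iff_ofReal]
  · exact h.lintegral_sq_lt_top
  · filter_upwards [ae_restrict_mem measurableSet_Ici] with t ht
    have := h.δ_pos t ht
    positivity

/-- By local integrability, an initial segment contributes a finite amount, so the divergence is
carried by every tail. -/
theorem CoefficientConditions.not_integrableOn_mul (h : CoefficientConditions t₀ α₀ α₁ δ lam)
    {T : ℝ} (hT : t₀ ≤ T) : ¬ IntegrableOn (fun t => δ t * α₀ t) (Ici T) := by
  intro hint
  have h1 : IntegrableOn (fun t => δ t * α₀ t) (Ici t₀) := by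
    rw [← Icc_union_Ici_eq_Ici hT]
    exact (h.locallyIntegrableOn_mul.integrableOn_compact_subset Icc_subset_Ici_self
      isCompact_Icc).union hint
  have h2 := h1.2
  rw [hasFiniteIntegral_iff_ofReal, h.lintegral_eq_top] at h2
  · exact lt_irrefl _ h2
  · filter_upwards [ae_restrict_mem measurableSet_Ici] with t ht
    exact (mul_pos (h.δ_pos t ht) (h.α₀_pos t ht)).le

theorem CoefficientConditions.locallyACFrom_sub (h : CoefficientConditions t₀ α₀ α₁ δ lam) :
    LocallyACFrom t₀ fun s => α₁ s - δ s * lam s := fun b c hb hbc =>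
  (h.α₁_ac b c hb hbc).fun_sub ((h.δ_ac b c hb hbc).fun_mul (h.lam_ac b c hb hbc))

end Coefficients

/-! ### From the energy estimates to the variational inequality -/

/-- Monotonicity and `⟪U p, w - p⟫ ≥ 0` force both products with `w - p` to vanish; paramonotonicity
then yields `U w = U p`, and the inequality at `p` transfers to `w`. -/
theorem mem_viSolutionSet_of_inner_le_zero {E : Type*} [NormedAddCommGroup E]
    [InnerProductSpace ℝ E] {U : E → E} {Ω : Set E} (hU : IsParamonotoneOn U Ω) {p w : E}
    (hp : p ∈ viSolutionSet U Ω) (hw : w ∈ Ω) (h : inner ℝ (U w) (w - p) ≤ 0) :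
    w ∈ viSolutionSet U Ω := by
  have h1 := hU.1 w hw p hp.1
  have h2 := hp.2 w hw
  rw [inner_sub_left] at h1
  have h3 : U w = U p := (hU.2 w hw p hp.1).1 (by rw [inner_sub_left]; linarith)
  refine ⟨hw, fun a ha => ?_⟩
  have h4 := hp.2 a ha
  have e : inner ℝ (U p) (a - w) = inner ℝ (U p) (a - p) - inner ℝ (U p) (w - p) := by
    rw [← inner_sub_right]
    congr 1
    abel
  rw [h3] at h
  rw [h3, e]
  linarith

section Solution

variable {E : Type*} [NormedAddCommGroup E] [InnerProductSpace ℝ E]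
  {U : E → E} {Ω : Set E} {t₀ : ℝ} {α₀ α₁ δ lam : ℝ → ℝ} {x₀ x₁ : E} {x x' x'' : ℝ → E}

/-- Splitting `y - x = (y - z) + lam x'` moves the extrapolation into the damping and leaves a
forcing of norm at most `α₀` when `z ∈ Ω`. -/
theorem IsStrongGlobalSolution.equation_sub
    (hx : IsStrongGlobalSolution U Ω t₀ α₀ α₁ δ lam x₀ x₁ x x' x'') :
    ∀ᵐ t ∂(volume.restrict (Ici t₀)), x'' t + (α₁ t - δ t * lam t) • x' t =
      δ t • (projStep U Ω (α₀ t) (x t + lam t • x' t) - (x t + lam t • x' t)) := by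
  filter_upwards [hx.equation] with t ht
  rw [sub_smul, ← add_sub_assoc, ht, mul_smul, ← smul_sub, sub_sub]

variable [CompleteSpace E]

theorem IsStrongGlobalSolution.exists_isDampedSystem (hne : Ω.Nonempty)
    (hcl : IsClosed Ω) (hcv : Convex ℝ Ω) (hcoef : CoefficientConditions t₀ α₀ α₁ δ lam)
    (hx₀ : x₀ ∈ Ω) (hx₁ : x₁ ∈ Ω)
    (hx : IsStrongGlobalSolution U Ω t₀ α₀ α₁ δ lam x₀ x₁ x x' x'') :
    ∃ C₁ C₂, ∀ T, t₀ < T → IsDampedSystem T C₁ C₂ α₀ (fun s => α₁ s - δ s * lam s) δ x x' x''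
      fun t => projStep U Ω (α₀ t) (x t + lam t • x' t) - (x t + lam t • x' t) := by
  obtain ⟨C₁, hC₁, C₂, hC₂, hdamp⟩ := hcoef.damping
  refine ⟨C₁, C₂, fun T hT => ?_⟩
  have hsub : Ici T ⊆ Ici t₀ := Ici_subset_Ici.2 hT.le
  exact
    { C₁_pos := hC₁
      C₂_pos := hC₂
      δ_nonneg := fun t ht => (hcoef.δ_pos t (hsub ht)).le
      damping := fun t ht => by linarith [hdamp t (hsub ht)]
      a_ac := fun b c hb hbc => hcoef.locallyACFrom_sub b c (hsub hb) hbc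
      deriv_nonpos := ae_restrict_of_ae_restrict_of_subset hsub hcoef.deriv_nonpos
      integrable := hcoef.integrableOn_mul_sq.mono_set hsub
      hasDeriv := fun t ht => (hx.hasDeriv t (hsub ht)).hasDerivAt (Ici_mem_nhds (hT.trans_le ht))
      hasDeriv' := fun t ht =>
        (hx.hasDeriv' t (hsub ht)).hasDerivAt (Ici_mem_nhds (hT.trans_le ht))
      continuousOn'' := hx.continuousOn''.mono fun t ht => hT.trans_le ht
      equation := ae_restrict_of_ae_restrict_of_subset hsub hx.equation_sub
      norm_le := by
        filter_upwards [ae_restrict_mem measurableSet_Ici] with t ht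
        exact norm_projStep_sub_le hne hcl hcv (hcoef.α₀_pos t (hsub ht)).le
          (hx.add_smul_mem hne hcl hcv hcoef hx₀ hx₁ t (hsub ht)) }

/-- The acceleration of a strong global solution is square integrable. -/
theorem IsStrongGlobalSolution.memLp (hne : Ω.Nonempty)
    (hcl : IsClosed Ω) (hcv : Convex ℝ Ω) (hcoef : CoefficientConditions t₀ α₀ α₁ δ lam)
    (hx₀ : x₀ ∈ Ω) (hx₁ : x₁ ∈ Ω)
    (hx : IsStrongGlobalSolution U Ω t₀ α₀ α₁ δ lam x₀ x₁ x x' x'') :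
    MemLp (fun t => ‖x'' t‖) 2 (volume.restrict (Ici t₀)) := by
  obtain ⟨C₁, hC₁, C₂, hC₂, hdamp⟩ := hcoef.damping
  obtain ⟨_, _, hsys⟩ := hx.exists_isDampedSystem hne hcl hcv hcoef hx₀ hx₁
  set a : ℝ → ℝ := fun s => α₁ s - δ s * lam s
  have ha : ∀ t, t₀ ≤ t → a t ≤ a t₀ := fun t ht =>
    (hcoef.locallyACFrom_sub t₀ t le_rfl ht).le_of_ae_deriv_nonpos ht
      (ae_restrict_of_ae_restrict_of_subset Icc_subset_Ici_self hcoef.deriv_nonpos)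
  have hdamp' : ∀ t, t₀ ≤ t → C₁ + C₂ * δ t ≤ 2 * a t := fun t ht => by
    simp only [a]
    linarith [hdamp t ht]
  have hc' : ContinuousOn x' (Ici t₀) := fun t ht => (hx.hasDeriv' t ht).continuousWithinAt
  -- The damped system starts only after `t₀`, where derivatives are two-sided; the initial segment
  -- is covered by continuity of `x'`.
  have hv : IntegrableOn (fun t => ‖x' t‖ ^ 2) (Ici t₀) := by
    rw [← Icc_union_Ici_eq_Ici (lt_add_one t₀).le]
    exact ((hc'.mono Icc_subset_Ici_self).norm.pow 2 |>.integrableOn_Icc).union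
      (hsys _ (lt_add_one t₀)).velocity.1
  have hmeas : AEStronglyMeasurable (fun t => ‖x'' t‖) (volume.restrict (Ici t₀)) := by
    rw [← Measure.restrict_congr_set Ioi_ae_eq_Ici]
    exact hx.continuousOn''.norm.aestronglyMeasurable measurableSet_Ioi
  rw [memLp_two_iff_integrable_sq hmeas]
  refine Integrable.mono' ((hcoef.integrableOn_mul_sq.const_mul (2 * (2 * a t₀ / C₂))).add
    (hv.const_mul (2 * a t₀ ^ 2))) (hmeas.pow 2) ?_
  filter_upwards [hx.equation_sub, ae_restrict_mem measurableSet_Ici] with t h1 ht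
  set q := projStep U Ω (α₀ t) (x t + lam t • x' t) - (x t + lam t • x' t)
  have hδ := hcoef.δ_pos t ht
  have hq : ‖q‖ ≤ α₀ t := norm_projStep_sub_le hne hcl hcv (hcoef.α₀_pos t ht).le
    (hx.add_smul_mem hne hcl hcv hcoef hx₀ hx₁ t ht)
  have hat : 0 ≤ a t := by nlinarith [hdamp' t ht]
  have hD : δ t ≤ 2 * a t₀ / C₂ := by
    rw [le_div_iff₀ hC₂]
    linarith [hdamp' t ht, ha t ht]
  have h2 : ‖x'' t‖ ≤ δ t * α₀ t + a t₀ * ‖x' t‖ := by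
    rw [eq_sub_of_add_eq h1]
    refine (norm_sub_le _ _).trans (add_le_add ?_ ?_)
    · rw [norm_smul, Real.norm_of_nonneg hδ.le]
      exact mul_le_mul_of_nonneg_left hq hδ.le
    · rw [norm_smul, Real.norm_of_nonneg hat]
      exact mul_le_mul_of_nonneg_right (ha t ht) (norm_nonneg _)
  rw [Real.norm_of_nonneg (by positivity)]
  have h3 := pow_le_pow_left₀ (norm_nonneg _) h2 2
  have h4 := mul_le_mul_of_nonneg_right hD (by positivity : 0 ≤ δ t * α₀ t ^ 2)
  simp only [Pi.add_apply]
  nlinarith [sq_nonneg (δ t * α₀ t - a t₀ * ‖x' t‖)]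

/-- The minorant `k` of the gain is left free: `k = 0` yields convergence of distances, and a
multiple of `δ α₀` yields a contradiction with divergence. -/
theorem IsStrongGlobalSolution.distance (hne : Ω.Nonempty)
    (hcl : IsClosed Ω) (hcv : Convex ℝ Ω) (hcoef : CoefficientConditions t₀ α₀ α₁ δ lam)
    (hx₀ : x₀ ∈ Ω) (hx₁ : x₁ ∈ Ω)
    (hx : IsStrongGlobalSolution U Ω t₀ α₀ α₁ δ lam x₀ x₁ x x' x'') {T : ℝ} (hT : t₀ < T)
    (hv : ∀ t, T ≤ t → ‖x' t‖ ≤ 1) {p : E} (hp : p ∈ Ω) {k : ℝ → ℝ}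
    (hk : LocallyIntegrableOn k (Ici T)) (hk0 : ∀ t, T ≤ t → 0 ≤ k t)
    (hkU : ∀ t, T ≤ t → k t ≤ δ t * (α₀ t / max 1 ‖U (x t + lam t • x' t)‖ *
      inner ℝ (U (x t + lam t • x' t)) (x t + lam t • x' t - p))) :
    IntegrableOn k (Ici T) ∧ ∃ r, Tendsto (fun t => ‖x t - p‖) atTop (𝓝 r) := by
  obtain ⟨_, _, hsys⟩ := hx.exists_isDampedSystem hne hcl hcv hcoef hx₀ hx₁
  obtain ⟨L, hL⟩ := hcoef.lam_bdd
  refine (hsys T hT).distance (lam := lam) (L := L) (fun t ht => ?_) hv p hk hk0 ?_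
  · rw [abs_of_nonneg (hcoef.lam_nonneg t (hT.le.trans ht))]
    exact hL ⟨t, hT.le.trans ht, rfl⟩
  · filter_upwards [ae_restrict_mem measurableSet_Ici] with t ht
    have ht0 : t₀ ≤ t := hT.le.trans ht
    have hα := hcoef.α₀_pos t ht0
    have hδ := hcoef.δ_pos t ht0
    have h1 := inner_projStep_sub_le (U := U) hne hcl hcv hα.le (x t + lam t • x' t) hp
    have h2 := norm_projStep_sub_le (U := U) hne hcl hcv hα.le
      (hx.add_smul_mem hne hcl hcv hcoef hx₀ hx₁ t ht0)
    have h3 := mul_le_mul_of_nonneg_left h2 hα.le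
    have h4 := mul_le_mul_of_nonneg_left (h1.trans (sub_le_sub_right
      ((sub_le_self _ (sq_nonneg _)).trans h3) _)) hδ.le
    have h5 := hkU t ht
    rw [mul_sub] at h4
    rw [pow_two]
    linarith

end Solution

/-! ### Convergence to a solution -/

theorem mainTheorem1 (d : ℕ) (Ω : Set (EuclideanSpace ℝ (Fin d)))
    (U : EuclideanSpace ℝ (Fin d) → EuclideanSpace ℝ (Fin d))
    (hΩne : Ω.Nonempty) (hΩcl : IsClosed Ω) (hΩcv : Convex ℝ Ω)
    (hsol : (viSolutionSet U Ω).Nonempty)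
    (hUpara : IsParamonotoneOn U Ω) (hUcont : ContinuousOn U Ω)
    (t₀ : ℝ) (α₀ α₁ δ lam : ℝ → ℝ) (hcoef : CoefficientConditions t₀ α₀ α₁ δ lam)
    (x₀ x₁ : EuclideanSpace ℝ (Fin d)) (hx₀ : x₀ ∈ Ω) (hx₁ : x₁ ∈ Ω)
    (x x' x'' : ℝ → EuclideanSpace ℝ (Fin d))
    (hx : IsStrongGlobalSolution U Ω t₀ α₀ α₁ δ lam x₀ x₁ x x' x'') :
    MemLp (fun t => ‖x'' t‖) 2 (volume.restrict (Ici t₀)) ∧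
      Tendsto x' atTop (𝓝 0) ∧
      ∃ xs ∈ viSolutionSet U Ω, Tendsto x atTop (𝓝 xs) := by
  obtain ⟨_, _, hsys⟩ := hx.exists_isDampedSystem hΩne hΩcl hΩcv hcoef hx₀ hx₁
  have hv0 := (hsys _ (lt_add_one t₀)).velocity.2
  refine ⟨hx.memLp hΩne hΩcl hΩcv hcoef hx₀ hx₁, hv0, ?_⟩
  set z : ℝ → EuclideanSpace ℝ (Fin d) := fun t => x t + lam t • x' t with hz
  have hzΩ : ∀ t, t₀ ≤ t → z t ∈ Ω := hx.add_smul_mem hΩne hΩcl hΩcv hcoef hx₀ hx₁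
  obtain ⟨T, hT⟩ : ∃ T, ∀ t, T ≤ t → t₀ + 1 ≤ t ∧ ‖x' t‖ ≤ 1 := by
    refine eventually_atTop.1 ((eventually_ge_atTop _).and ?_)
    have h1 := (tendsto_zero_iff_norm_tendsto_zero.1 hv0).eventually (gt_mem_nhds one_pos)
    exact h1.mono fun t ht => ht.le
  have hT0 : t₀ < T := by linarith [(hT T le_rfl).1]
  obtain ⟨L, hL⟩ := hcoef.lam_bdd
  have hzx : Tendsto (fun t => z t - x t) atTop (𝓝 0) := by
    rw [tendsto_zero_iff_norm_tendsto_zero]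
    have h1 : Tendsto (fun t => L * ‖x' t‖) atTop (𝓝 0) := by
      simpa using (tendsto_zero_iff_norm_tendsto_zero.1 hv0).const_mul L
    refine squeeze_zero' (Eventually.of_forall fun _ => norm_nonneg _) ?_ h1
    filter_upwards [eventually_ge_atTop t₀] with t ht
    simp only [hz]
    rw [add_sub_cancel_left, norm_smul, Real.norm_of_nonneg (hcoef.lam_nonneg t ht)]
    exact mul_le_mul_of_nonneg_right (hL ⟨t, ht, rfl⟩) (norm_nonneg _)
  have hV0 : ∀ p ∈ viSolutionSet U Ω, ∀ t, t₀ ≤ t → 0 ≤ inner ℝ (U (z t)) (z t - p) := by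
    intro p hp t ht
    have h1 := hUpara.1 _ (hzΩ t ht) p hp.1
    have h2 := hp.2 _ (hzΩ t ht)
    rw [inner_sub_left] at h1
    linarith
  have hdist : ∀ p ∈ viSolutionSet U Ω, ∃ r, Tendsto (fun t => ‖x t - p‖) atTop (𝓝 r) := by
    intro p hp
    refine (hx.distance hΩne hΩcl hΩcv hcoef hx₀ hx₁ hT0 (fun t ht => (hT t ht).2) hp.1
      (k := fun _ => 0) (continuousOn_const.locallyIntegrableOn measurableSet_Ici)
      (fun _ _ => le_rfl) fun t ht => ?_).2
    have ht0 := hT0.le.trans ht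
    have h1 := hV0 p hp t ht0
    have h2 := hcoef.α₀_pos t ht0
    have h3 := hcoef.δ_pos t ht0
    positivity
  obtain ⟨p, hp⟩ := hsol
  obtain ⟨r, hr⟩ := hdist p hp
  have hbd : ∀ᶠ t in atTop, z t ∈ Ω ∩ Metric.closedBall p (r + 1 + 1) := by
    filter_upwards [hr.eventually (gt_mem_nhds (lt_add_one r)),
      (tendsto_zero_iff_norm_tendsto_zero.1 hzx).eventually (gt_mem_nhds one_pos),
      eventually_ge_atTop t₀] with t h1 h2 ht
    refine ⟨hzΩ t ht, ?_⟩
    rw [mem_closedBall_iff_norm]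
    have h3 := norm_add_le (x t - p) (z t - x t)
    rw [add_comm, sub_add_sub_cancel] at h3
    linarith
  have hK : IsCompact (Ω ∩ Metric.closedBall p (r + 1 + 1)) :=
    (isCompact_closedBall _ _).inter_left hΩcl
  obtain ⟨B, hB⟩ := hK.exists_bound_of_continuousOn (hUcont.mono inter_subset_left)
  have hfreq : ∀ n : ℕ, ∃ t, (n : ℝ) ≤ t ∧ z t ∈ Ω ∩ Metric.closedBall p (r + 1 + 1) ∧
      inner ℝ (U (z t)) (z t - p) < 1 / ((n : ℝ) + 1) := by
    intro n
    by_contra! hcon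
    have hε : 0 < 1 / ((n : ℝ) + 1) := by positivity
    set ε := 1 / ((n : ℝ) + 1)
    obtain ⟨N, hN⟩ := eventually_atTop.1 hbd
    set T' := max T (max N n)
    have hTT' : T ≤ T' := le_max_left _ _
    have hT'0 : t₀ < T' := hT0.trans_le hTT'
    -- If the gain stayed above `ε` while `‖U z‖ ≤ B`, then `c δ α₀` would be an admissible
    -- minorant, making `δ α₀` integrable on a tail.
    set c := ε / max 1 B
    have hc : 0 < c := by positivity
    have hint := (hx.distance hΩne hΩcl hΩcv hcoef hx₀ hx₁ hT'0
      (fun t ht => (hT t (hTT'.trans ht)).2) hp.1 (k := fun t => c * (δ t * α₀ t))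
      ((hcoef.locallyIntegrableOn_mul.mono_set (Ici_subset_Ici.2 hT'0.le)).continuousOn_mul
        continuousOn_const isLocallyClosed_Ici)
      (fun t ht => ?_) fun t ht => ?_).1
    · refine hcoef.not_integrableOn_mul hT'0.le ?_
      have h := hint.const_mul c⁻¹
      simp only [inv_mul_cancel_left₀ hc.ne'] at h
      exact h
    · have h2 := hcoef.α₀_pos t (hT'0.le.trans ht)
      have h3 := hcoef.δ_pos t (hT'0.le.trans ht)
      positivity
    · have h2 := hcoef.α₀_pos t (hT'0.le.trans ht)
      have h3 := hcoef.δ_pos t (hT'0.le.trans ht)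
      have hmem := hN t (((le_max_left _ _).trans (le_max_right _ _)).trans ht)
      have h4 : ε ≤ inner ℝ (U (z t)) (z t - p) :=
        hcon t (((le_max_right _ _).trans (le_max_right _ _)).trans ht) hmem
      have h5 : max 1 ‖U (z t)‖ ≤ max 1 B := max_le_max_left _ (hB _ hmem)
      have h6 : α₀ t / max 1 B ≤ α₀ t / max 1 ‖U (z t)‖ :=
        div_le_div_of_nonneg_left h2.le (by positivity) h5
      have h7 := mul_le_mul h6 h4 hε.le (by positivity)
      have h8 := mul_le_mul_of_nonneg_left h7 h3.le
      refine le_trans (le_of_eq ?_) h8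
      simp only [c]
      ring
  choose τ hτn hτK hτV using hfreq
  have hτ : Tendsto τ atTop atTop := tendsto_atTop_mono hτn tendsto_natCast_atTop_atTop
  obtain ⟨w, hw, φ, hφ, hlim⟩ := hK.tendsto_subseq hτK
  have hUlim : Tendsto (fun n => U (z (τ (φ n)))) atTop (𝓝 (U w)) :=
    (hUcont w hw.1).tendsto.comp (tendsto_nhdsWithin_iff.2
      ⟨hlim, Eventually.of_forall fun n => (hτK (φ n)).1⟩)
  have hle : inner ℝ (U w) (w - p) ≤ 0 :=
    le_of_tendsto_of_tendsto' (hUlim.inner (hlim.sub_const p))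
      (tendsto_one_div_add_atTop_nhds_zero_nat.comp hφ.tendsto_atTop) fun n => (hτV (φ n)).le
  have hwS := mem_viSolutionSet_of_inner_le_zero hUpara hp hw.1 hle
  refine ⟨w, hwS, ?_⟩
  -- The cluster point is itself a solution, so the distance to it has a limit, which the
  -- subsequence identifies as `0`.
  obtain ⟨s, hs⟩ := hdist w hwS
  have hsub : Tendsto (fun n => τ (φ n)) atTop atTop := hτ.comp hφ.tendsto_atTop
  have hxw : Tendsto (fun n => ‖x (τ (φ n)) - w‖) atTop (𝓝 0) := by
    have h1 := (hlim.sub_const w).sub (hzx.comp hsub)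
    simpa using h1.norm
  rw [tendsto_iff_norm_sub_tendsto_zero, ← tendsto_nhds_unique (hs.comp hsub) hxw]
  exact hs
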